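/- Let $n\ge 0$ and let $\mathbf a=(a_1,\dots,a_n)\in\mathbb N^n$ (with $0\in\mathbb N$), where $a_1\neq 0$ if $n\ge 1$. Let $K_{n+1}$ be the complete graph on the vertices $1,\dots,n+1$ with every edge $(i,j)$, $i<j$, directed from $i$ to $j$, and let $\mathbf{Flow}_n(\mathbf a)$ be its flow polytope with netflow vector $(a_1,\dots,a_n,-\sum_i a_i)$, i.e. the set of all $f\colon E(K_{n+1})\to\mathbb R_{\ge 0}$ with $$\sum_{j>i}f(i,j)-\sum_{k<i}f(k,i)=a_i\qquad(1\le i\le n).$$ Let $f^{(n)}(\mathbf a;x)=\sum_{d\ge -1}f_d\,x^d\in\mathbb Z[x,x^{-1}]$ be its $f$-polynomial, where $f_d$ is the number of $d$-dimensional faces (the empty face has dimension $-1$, and the polytope is a face of itself). Let $\alpha=\mathrm{revcomp}(\mathbf a)$ be the composition of $n$ whose set of partial sums strictly between $0$ and $n$ is $\{\,n-j : 1\le j\le n-1,\ a_{j+1}\neq 0\,\}$; equivalently, read $\mathbf a$ from right to left, close a block at each nonzero entry, and record the block sizes. For compositions $\alpha,\beta$ of $n$ write $\beta\succeq\alpha$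 if $\beta$ refines $\alpha$ (each part of $\alpha$ is a sum of consecutive parts of $\beta$), let $\ell(\beta)$ be the number of parts of $\beta$, and put $\mathbf x^{\beta-\mathbf 1}=\prod_{i=1}^{\ell(\beta)}x_i^{\beta_i-1}$. Let $[m]_q!=\prod_{i=1}^m(1+q+\dots+q^{i-1})$ and $\pi_m(x_0)=x_0^m[m]_{x_0+1}!=\prod_{i=1}^m((x_0+1)^i-1)$, and define the Laurent polynomial $$Q_\alpha(x_0,x_1,\dots,x_n)=\frac1{x_0}+\frac1{x_0^n}\sum_{\beta\succeq\alpha}(-1)^{n-\ell(\beta)}\,\pi_{\ell(\beta)}(x_0)\,\mathbf x^{\beta-\mathbf 1}.$$ Then $\mathbf{Flow}_n(\mathbf a)$ has finitely many faces, and $$f^{(n)}(\mathbf a;x)=Q_\alpha\bigl(x,\,(x+1)^1-(x+1),\,(x+1)^2-(x+1),\dots,(x+1)^n-(x+1)\bigr).$$ In particular, if all $a_i>0$, then $f^{(n)}(\mathbf a;x)=\frac1x+[n]_{x+1}!$. -/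

import Mathlib

open scoped LaurentPolynomial

noncomputable section

/-! ### Faces and the `f`-polynomial of a polytope -/

section Faces

variable {V : Type*} [AddCommGroup V] [Module ℝ V] [TopologicalSpace V]

/-- The set of faces of a polytope `P`: the empty face, together with the nonempty sets of all
maximizers over `P` of a linear functional (the zero functional gives `P` itself). -/
def polytopeFaces (P : Set V) : Set (Set V) := {F | IsExposed ℝ P F}

open Classical in
/-- The dimension of a face is the dimension of its affine span; the empty face has
dimension `-1`. -/
def faceDim (F : Set V) : ℤ :=
  if F.Nonempty then (Module.finrank ℝ (vectorSpan ℝ F) : ℤ) else -1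

/-- The number of `d`-dimensional faces of `P`. -/
def fVector (P : Set V) (d : ℤ) : ℕ := {F ∈ polytopeFaces P | faceDim F = d}.ncard

/-- The `f`-polynomial of `P`, the Laurent polynomial in which the coefficient of `x ^ d` is the
number of `d`-dimensional faces of `P`, for all `d ≥ -1`. (No face has a dimension above that
of the ambient space.) -/
def fPolynomial (P : Set V) : ℤ[T;T⁻¹] :=
  ∑ d ∈ Finset.Icc (-1 : ℤ) (Module.finrank ℝ V),
    LaurentPolynomial.C (fVector P d : ℤ) * LaurentPolynomial.T d

end Faces

/-! ### Flow polytopes -/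

/-- A nonnegative flow with netflow vector `a` on the directed graph with vertices `0, …, n` and
edge set `E`: at each vertex except the last, outgoing flow minus incoming flow is the netflow. -/
def IsFlow {n : ℕ} (E : Finset (Fin (n + 1) × Fin (n + 1))) (a : Fin (n + 1) → ℤ)
    (f : E → ℝ) : Prop :=
  (∀ e, 0 ≤ f e) ∧
    ∀ i : Fin n, (∑ e : E with e.1.1 = i.castSucc, f e) - (∑ e : E with e.1.2 = i.castSucc, f e)
      = a i.castSucc

/-- The flow polytope of a directed graph and a netflow vector. -/
def flowPolytope {n : ℕ} (E : Finset (Fin (n + 1) × Fin (n + 1))) (a : Fin (n + 1) → ℤ) :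
    Set (E → ℝ) :=
  {f | IsFlow E a f}

/-- The edges of the complete graph on `n + 1` vertices, directed from smaller to larger vertex. -/
def completeEdges (n : ℕ) : Finset (Fin (n + 1) × Fin (n + 1)) := {e | e.1 < e.2}

/-- The netflow vector `(a₁, …, aₙ, -(a₁ + ⋯ + aₙ))`. -/
def netflow {n : ℕ} (a : Fin n → ℕ) : Fin (n + 1) → ℤ :=
  Fin.snoc (α := fun _ => ℤ) (fun i => (a i : ℤ)) (-∑ i, (a i : ℤ))

/-- The flow polytope of the complete graph on `n + 1` vertices with netflow
`(a₁, …, aₙ, -(a₁ + ⋯ + aₙ))`. -/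
def completeFlowPolytope {n : ℕ} (a : Fin n → ℕ) : Set (completeEdges n → ℝ) :=
  flowPolytope (completeEdges n) (netflow a)

/-! ### Compositions -/

/-- The composition of `n` whose partial sums are `0`, `n` and all `n - j` for `1 ≤ j ≤ n - 1` with
`a_{j+1} ≠ 0`. With `a` indexed from zero, the entry `a i` (here `i = j`) gives the partial sum
`n - i`; the entry `i = 0` gives only the partial sum `n`. The parts are the lengths of the blocks
obtained by reading `a` from right to left and closing a block at each nonzero entry. -/
def revcomp {n : ℕ} (a : Fin n → ℕ) : Composition n :=
  CompositionAsSet.toComposition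
    { boundaries := insert 0 (insert (Fin.last n)
        ((Finset.univ.filter fun i : Fin n => a i ≠ 0).image fun i => i.castSucc.rev))
      zero_mem := by simp
      getLast_mem := by simp }

/-- `β` refines `α`: each part of `α` is a sum of consecutive parts of `β`, that is, the partial
sums of `α` are among those of `β`. -/
def Refines {n : ℕ} (β α : Composition n) : Prop := α.boundaries ⊆ β.boundaries

instance {n : ℕ} (β α : Composition n) : Decidable (Refines β α) :=
  inferInstanceAs (Decidable (α.boundaries ⊆ β.boundaries))

/-! ### The Laurent polynomial `Q_α` -/

section Q

variable {R : Type*} [CommRing R]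

/-- `[m]_q ! = ∏_{i=1}^m (1 + q + ⋯ + q^{i-1})`. -/
def qFactorial (m : ℕ) (q : R) : R :=
  ∏ i ∈ Finset.range m, ∑ j ∈ Finset.range (i + 1), q ^ j

/-- `π_m(x) = x^m [m]_{x+1}!`. -/
def qPi (m : ℕ) (x : R) : R := x ^ m * qFactorial m (x + 1)

theorem qPi_eq_prod (m : ℕ) (x : R) :
    qPi m x = ∏ i ∈ Finset.range m, ((x + 1) ^ (i + 1) - 1) := by
  have h : ∀ i, (x + 1) ^ (i + 1) - 1 = x * ∑ j ∈ Finset.range (i + 1), (x + 1) ^ j := by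
    intro i
    have := mul_geom_sum (x + 1) (i + 1)
    rw [← this]
    ring
  simp [qPi, qFactorial, h, Finset.prod_mul_distrib]

end Q

/-- The monomial `x^{β - 1} = x_1^{β_1 - 1} ⋯ x_ℓ^{β_ℓ - 1}`. The variable `x_i` with
`1 ≤ i ≤ n` is `X` at the index `i - 1 : Fin n`. -/
def monomialSubOne {n : ℕ} (β : Composition n) : MvPolynomial (Fin n) ℤ :=
  ∏ i : Fin β.length, MvPolynomial.X (Fin.castLE β.length_le i) ^ (β.blocksFun i - 1)

/-- `Q_α = 1/x_0 + (1/x_0^n) ∑_{β refines α} (-1)^{n - ℓ(β)} π_{ℓ(β)}(x_0) x^{β - 1}`, a Laurent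
polynomial in `x_0 = T 1` whose coefficients are polynomials in `x_1, …, x_n`. Here `n = |α|` is
the sum of the parts of `α`, and `ℓ(β) ≤ n` always holds. -/
def laurentQ {n : ℕ} (α : Composition n) : LaurentPolynomial (MvPolynomial (Fin n) ℤ) :=
  LaurentPolynomial.T (-1) + LaurentPolynomial.T (-(n : ℤ)) *
    ∑ β : Composition n with Refines β α,
      (-1) ^ (n - β.length) * qPi β.length (LaurentPolynomial.T 1) *
        LaurentPolynomial.C (monomialSubOne β)

/-- The variable `x` of `ℤ[x, x⁻¹]` as a unit. -/
def laurentX : (ℤ[T;T⁻¹])ˣ where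
  val := LaurentPolynomial.T 1
  inv := LaurentPolynomial.T (-1)
  val_inv := by rw [← LaurentPolynomial.T_add]; simp
  inv_val := by rw [← LaurentPolynomial.T_add]; simp

/-- Substitution of `x_0 = u` and `x_i = v_i` for `1 ≤ i ≤ n` (where `v_i` is `v` at the index
`i - 1 : Fin n`) in a Laurent polynomial in `x_0` over the polynomials in `x_1, …, x_n`. -/
def laurentEval {n : ℕ} {R : Type*} [CommRing R] (u : Rˣ) (v : Fin n → R) :
    LaurentPolynomial (MvPolynomial (Fin n) ℤ) →+* R :=
  LaurentPolynomial.eval₂ (MvPolynomial.eval₂Hom (Int.castRingHom R) v) u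

end

/-!
# The `f`-polynomial of the flow polytope of a complete graph

The nonempty faces of a polyhedron `{f ≥ 0 | L f = b}` correspond to the supports `S` of its points,
the face of `S` consisting of the points supported in `S` (`polytopeFaces_stdPolyhedron`). Its
direction space consists of the vectors of `ker L` supported in `S`, so rank-nullity gives its
dimension. For the flow polytope, an edge set `S` is a support exactly if a vertex has an outgoing
edge in `S` when and only when it has an incoming edge in `S` or a nonzero netflow
(`isSupportOf_completeFlowPolytope`). The balance equations at the vertices with an outgoing edge
are then independent, so the face of `S` has dimension `∑ (|O i| - 1)`, the sum over the vertices
`i` with out-neighbourhood `O i ≠ ∅` (`finrank_vectorSpan_flowFace`).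

The `f`-polynomial is therefore `1 / x` plus a sum of `∏ x ^ (|O i| - 1)` over families of
out-neighbourhoods. Inclusion–exclusion over a set `U` of vertices of netflow zero that are required
to have no incoming edge makes the out-neighbourhoods independent (`sum_isFlowFamily`). If `k` is
the number of vertices larger than `i`, sink included, that lie outside `U`, then `x` times the
factor of `i` is `(x + 1) ^ k - 1` for `i ∉ U` and `(x + 1) - (x + 1) ^ k` for `i ∈ U`.

Finally, read the vertices from right to left and close a block at each vertex outside `U`. As the
first vertex has nonzero netflow, this matches the sets `U` with the compositions `β` refining
`revcomp a`. The number `k` is constant on each block, equal to `1, 2, …, ℓ(β)` on the successive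
blocks, and a block contains one vertex outside `U` and `β_i - 1` vertices of `U`. The product of
the factors is thus the term of `β` in `Q_α` (`prod_vertexFactor`).
-/

/-! ### Faces of a polyhedron in standard form -/

section Polyhedron

variable {E W : Type*} [AddCommGroup W] [Module ℝ W]

/-- The polyhedron `{f ≥ 0 | L f = b}` in standard form. -/
def stdPolyhedron (L : (E → ℝ) →ₗ[ℝ] W) (b : W) : Set (E → ℝ) :=
  {f | (∀ e, 0 ≤ f e) ∧ L f = b}

/-- The points of `P` whose support is contained in `S`. -/
def coordFace (P : Set (E → ℝ)) (S : Finset E) : Set (E → ℝ) :=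
  {f ∈ P | ∀ e, e ∉ S → f e = 0}

/-- `S` is the support of some point of `P`. -/
def IsSupportOf (P : Set (E → ℝ)) (S : Finset E) : Prop :=
  ∃ f ∈ P, ∀ e, e ∈ S ↔ f e ≠ 0

/-- A nonnegative vector can be moved a little in any direction that vanishes where it does. -/
theorem exists_pos_forall_nonneg_add_mul [Finite E] {f v : E → ℝ} (hf : ∀ e, 0 ≤ f e)
    (hv : ∀ e, f e = 0 → v e = 0) : ∃ ε : ℝ, 0 < ε ∧ ∀ e, 0 ≤ f e + ε * v e := by
  have h : ∀ e, ∀ᶠ ε : ℝ in nhdsWithin 0 (Set.Ioi 0), 0 ≤ f e + ε * v e := by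
    intro e
    rcases (hf e).eq_or_lt with h0 | h0
    · simp [← h0, hv e h0.symm]
    · have hc : Continuous fun ε : ℝ => f e + ε * v e := by fun_prop
      have := (hc.tendsto 0).eventually (lt_mem_nhds (by simpa using h0))
      exact (this.filter_mono nhdsWithin_le_nhds).mono fun _ h => h.le
  obtain ⟨ε, h1, h2⟩ := ((Filter.eventually_all.2 h).and self_mem_nhdsWithin).exists
  exact ⟨ε, h2, h1⟩

theorem convex_stdPolyhedron (L : (E → ℝ) →ₗ[ℝ] W) (b : W) : Convex ℝ (stdPolyhedron L b) := by
  rintro f ⟨hf, hf'⟩ g ⟨hg, hg'⟩ s t hs ht hst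
  refine ⟨fun e => ?_, ?_⟩
  · have := mul_nonneg hs (hf e)
    have := mul_nonneg ht (hg e)
    simpa using by linarith
  · rw [map_add, map_smul, map_smul, hf', hg', ← add_smul, hst, one_smul]

theorem IsSupportOf.coordFace_nonempty {P : Set (E → ℝ)} {S : Finset E} (h : IsSupportOf P S) :
    (coordFace P S).Nonempty := by
  obtain ⟨f, hf, hS⟩ := h
  exact ⟨f, hf, fun e he => by simpa [hS] using he⟩

theorem coordFace_injOn (P : Set (E → ℝ)) : Set.InjOn (coordFace P) {S | IsSupportOf P S} := by
  have key : ∀ S T, IsSupportOf P S → coordFace P S = coordFace P T → S ⊆ T := by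
    rintro S T ⟨f, hf, hS⟩ h e he
    by_contra hT
    have : f ∈ coordFace P T := h ▸ ⟨hf, fun e he => by simpa [hS] using he⟩
    exact (hS e).1 he (this.2 e hT)
  exact fun S hS T hT h => (key S T hS h).antisymm (key T S hT h.symm)

/-- Extension by zero of a function on `S`. -/
noncomputable def extendZero (S : Finset E) : (S → ℝ) →ₗ[ℝ] (E → ℝ) :=
  Function.ExtendByZero.linearMap ℝ (Subtype.val : S → E)

theorem extendZero_injective (S : Finset E) : Function.Injective (extendZero S) :=
  fun _ _ h => Function.extend_injective Subtype.val_injective _ h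

theorem mem_range_extendZero (S : Finset E) (v : E → ℝ) :
    v ∈ LinearMap.range (extendZero S) ↔ ∀ e, e ∉ S → v e = 0 := by
  constructor
  · rintro ⟨g, rfl⟩ e he
    exact Function.extend_apply' _ _ _ (by rintro ⟨x, rfl⟩; exact he x.2)
  · intro h
    refine ⟨fun e => v e, ?_⟩
    ext e
    by_cases he : e ∈ S
    · exact Subtype.val_injective.extend_apply (fun e : S => v e) 0 ⟨e, he⟩
    · rw [h e he]
      refine Function.extend_apply' (fun e : S => v e) (0 : E → ℝ) e ?_
      rintro ⟨x, rfl⟩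
      exact he x.2

theorem finrank_range_extendZero (S : Finset E) :
    Module.finrank ℝ (LinearMap.range (extendZero S)) = S.card := by
  rw [LinearMap.finrank_range_of_inj (extendZero_injective S)]
  simp

variable [Fintype E]

/-- The points supported in `S` maximize minus the sum of the coordinates outside `S`. -/
theorem isExposed_coordFace (L : (E → ℝ) →ₗ[ℝ] W) (b : W) (S : Finset E) :
    IsExposed ℝ (stdPolyhedron L b) (coordFace (stdPolyhedron L b) S) := by
  classical
  rintro ⟨f, hf, hfS⟩
  have key : ∀ g : E → ℝ, (-∑ e ∈ Sᶜ, ContinuousLinearMap.proj (R := ℝ) (φ := fun _ => ℝ) e) g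
      = -∑ e ∈ Sᶜ, g e := by
    intro g; simp
  refine ⟨-∑ e ∈ Sᶜ, ContinuousLinearMap.proj e, ?_⟩
  ext g
  simp only [coordFace, Set.mem_ofPred_eq, key]
  refine and_congr_right fun hg => ⟨fun h y hy => ?_, fun h => ?_⟩
  · rw [Finset.sum_eq_zero (s := Sᶜ) (f := g) fun e he => h e (by simpa using he)]
    have := Finset.sum_nonneg (s := Sᶜ) (f := y) fun e _ => hy.1 e
    linarith
  · have h1 := h f hf
    rw [Finset.sum_eq_zero (s := Sᶜ) (f := f) fun e he => hfS e (by simpa using he)] at h1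
    have h2 : ∑ e ∈ Sᶜ, g e = 0 :=
      le_antisymm (by linarith) (Finset.sum_nonneg fun e _ => hg.1 e)
    intro e he
    exact (Finset.sum_eq_zero_iff_of_nonneg fun e _ => hg.1 e).1 h2 e (by simpa using he)

/-- A nonempty face is cut out by the support of any of its points whose support is maximal:
from such a point one can move slightly away from every other point supported there. -/
theorem exists_coordFace_of_isExposed (L : (E → ℝ) →ₗ[ℝ] W) (b : W) {F : Set (E → ℝ)}
    (hF : IsExposed ℝ (stdPolyhedron L b) F) (hne : F.Nonempty) :
    ∃ S, IsSupportOf (stdPolyhedron L b) S ∧ F = coordFace (stdPolyhedron L b) S := by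
  classical
  have hconv := hF.convex (convex_stdPolyhedron L b)
  obtain ⟨S, hS⟩ := (Set.toFinite {S : Finset E | IsSupportOf F S}).exists_maximal (by
    obtain ⟨f, hf⟩ := hne
    exact ⟨Finset.univ.filter fun e => f e ≠ 0, f, hf, by simp⟩)
  obtain ⟨⟨f, hf, hfS⟩, hmax⟩ := hS
  have hsub : F ⊆ stdPolyhedron L b := hF.subset
  refine ⟨S, ⟨f, hsub hf, hfS⟩, ?_⟩
  obtain ⟨l, hl⟩ := hF hne
  ext g
  constructor
  · intro hg
    refine ⟨hsub hg, fun e he => ?_⟩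
    by_contra hge
    have hmid : (1 / 2 : ℝ) • f + (1 / 2 : ℝ) • g ∈ F :=
      hconv hf hg (by norm_num) (by norm_num) (by norm_num)
    have hT : IsSupportOf F (Finset.univ.filter
        fun e => ((1 / 2 : ℝ) • f + (1 / 2 : ℝ) • g) e ≠ 0) := ⟨_, hmid, by simp⟩
    have hpos : ∀ e, 0 ≤ f e ∧ 0 ≤ g e := fun e => ⟨(hsub hf).1 e, (hsub hg).1 e⟩
    have hle := hmax hT (fun e' he' => by
      have h1 := (hfS e').1 he'
      have h2 := lt_of_le_of_ne (hpos e').1 h1.symm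
      have h3 := (hpos e').2
      simp only [Finset.mem_filter, Finset.mem_univ, true_and, Pi.add_apply, Pi.smul_apply,
        smul_eq_mul]
      exact (by linarith : (0 : ℝ) < 1 / 2 * f e' + 1 / 2 * g e').ne')
    refine he (hle ?_)
    have h2 := lt_of_le_of_ne (hpos e).2 (Ne.symm hge)
    have h3 := (hpos e).1
    simp only [Finset.mem_filter, Finset.mem_univ, true_and, Pi.add_apply, Pi.smul_apply,
      smul_eq_mul]
    exact (by linarith : (0 : ℝ) < 1 / 2 * f e + 1 / 2 * g e).ne'
  · rintro ⟨hg, hgS⟩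
    obtain ⟨ε, hε, h⟩ := exists_pos_forall_nonneg_add_mul (f := f) (v := f - g) (hsub hf).1
      (fun e he => by
        have h1 : e ∉ S := by simpa [hfS] using he
        simp [he, hgS e h1])
    have hmem : f + ε • (f - g) ∈ stdPolyhedron L b :=
      ⟨by simpa using h, by simp [(hsub hf).2, hg.2]⟩
    rw [hl] at hf ⊢
    refine ⟨hg, fun y hy => (hf.2 y hy).trans ?_⟩
    have := hf.2 _ hmem
    simp only [map_add, map_smul, map_sub, smul_eq_mul] at this
    nlinarith

theorem polytopeFaces_stdPolyhedron (L : (E → ℝ) →ₗ[ℝ] W) (b : W) :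
    polytopeFaces (stdPolyhedron L b) =
      insert ∅ (coordFace (stdPolyhedron L b) '' {S | IsSupportOf (stdPolyhedron L b) S}) := by
  ext F
  simp only [polytopeFaces, Set.mem_ofPred_eq, Set.mem_insert_iff, Set.mem_image]
  constructor
  · intro h
    rcases F.eq_empty_or_nonempty with h0 | h0
    · exact Or.inl h0
    · obtain ⟨S, hS, rfl⟩ := exists_coordFace_of_isExposed L b h h0
      exact Or.inr ⟨S, hS, rfl⟩
  · rintro (rfl | ⟨S, -, rfl⟩)
    · exact fun h => absurd h Set.not_nonempty_empty
    · exact isExposed_coordFace L b S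

theorem mem_vectorSpan_coordFace {L : (E → ℝ) →ₗ[ℝ] W} {b : W} {S : Finset E}
    (hS : IsSupportOf (stdPolyhedron L b) S) (v : E → ℝ) :
    v ∈ vectorSpan ℝ (coordFace (stdPolyhedron L b) S) ↔ L v = 0 ∧ ∀ e, e ∉ S → v e = 0 := by
  constructor
  · intro hv
    rw [vectorSpan] at hv
    induction hv using Submodule.span_induction with
    | mem x hx =>
      obtain ⟨f, ⟨hf, hfS⟩, g, ⟨hg, hgS⟩, rfl⟩ := hx
      refine ⟨?_, fun e he => ?_⟩
      · simp [hf.2, hg.2]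
      · simp [hfS e he, hgS e he]
    | zero => simp
    | add x y _ _ hx hy =>
      exact ⟨by simp [hx.1, hy.1], fun e he => by simp [hx.2 e he, hy.2 e he]⟩
    | smul c x _ hx => exact ⟨by simp [hx.1], fun e he => by simp [hx.2 e he]⟩
  · rintro ⟨hv, hvS⟩
    obtain ⟨f, hf, hfS⟩ := hS
    obtain ⟨ε, hε, h⟩ := exists_pos_forall_nonneg_add_mul (f := f) (v := v) hf.1
      (fun e he => hvS e (by simpa [hfS] using he))
    have h0 : f ∈ coordFace (stdPolyhedron L b) S := ⟨hf, fun e he => by simpa [hfS] using he⟩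
    have h1 : f + ε • v ∈ coordFace (stdPolyhedron L b) S :=
      ⟨⟨by simpa using h, by simp [hf.2, hv]⟩, fun e he => by simp [h0.2 e he, hvS e he]⟩
    have h2 := vsub_mem_vectorSpan ℝ h1 h0
    have h3 := Submodule.smul_mem _ ε⁻¹ h2
    simpa [smul_smul, hε.ne'] using h3

/-- Rank-nullity on the vectors supported in `S`. -/
theorem finrank_vectorSpan_coordFace {L : (E → ℝ) →ₗ[ℝ] W} {b : W} {S : Finset E}
    (hS : IsSupportOf (stdPolyhedron L b) S) :
    Module.finrank ℝ ((LinearMap.range (extendZero S)).map L) +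
      Module.finrank ℝ (vectorSpan ℝ (coordFace (stdPolyhedron L b) S)) = S.card := by
  have h1 := LinearMap.finrank_range_add_finrank_ker (L ∘ₗ extendZero S)
  have h2 : vectorSpan ℝ (coordFace (stdPolyhedron L b) S) =
      (LinearMap.ker (L ∘ₗ extendZero S)).map (extendZero S) := by
    ext v
    rw [mem_vectorSpan_coordFace hS, ← mem_range_extendZero]
    constructor
    · rintro ⟨hv, g, rfl⟩
      exact ⟨g, hv, rfl⟩
    · rintro ⟨g, hg, rfl⟩
      exact ⟨hg, g, rfl⟩
  rw [h2, ← (Submodule.equivMapOfInjective _ (extendZero_injective S) _).finrank_eq]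
  rw [LinearMap.range_comp] at h1
  simpa using h1

end Polyhedron

/-! ### The `f`-polynomial as a sum over faces -/

theorem faceDim_mem_Icc {V : Type*} [AddCommGroup V] [Module ℝ V] [FiniteDimensional ℝ V]
    (F : Set V) : faceDim F ∈ Finset.Icc (-1 : ℤ) (Module.finrank ℝ V) := by
  rw [faceDim, Finset.mem_Icc]
  have := Submodule.finrank_le (vectorSpan ℝ F)
  split_ifs <;> constructor <;> omega

theorem fPolynomial_eq_sum {V : Type*} [AddCommGroup V] [Module ℝ V] [TopologicalSpace V]
    [FiniteDimensional ℝ V] {P : Set V} {s : Finset (Set V)} (hs : polytopeFaces P = s) :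
    fPolynomial P = ∑ F ∈ s, LaurentPolynomial.T (faceDim F) := by
  classical
  rw [fPolynomial, ← Finset.sum_fiberwise_of_maps_to (fun F _ => faceDim_mem_Icc F)]
  refine Finset.sum_congr rfl fun d _ => ?_
  rw [Finset.sum_congr rfl (g := fun _ => LaurentPolynomial.T d)
    (fun F hF => by rw [(Finset.mem_filter.1 hF).2])]
  have : fVector P d = (s.filter fun F => faceDim F = d).card := by
    rw [fVector, hs, ← Set.ncard_coe_finset]
    congr 1
    ext F; simp
  simp [this]

open Classical in
/-- The `f`-polynomial of a polyhedron in standard form is a sum over the supports of points. -/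
theorem fPolynomial_stdPolyhedron {E W : Type*} [Fintype E] [AddCommGroup W] [Module ℝ W]
    (L : (E → ℝ) →ₗ[ℝ] W) (b : W) :
    fPolynomial (stdPolyhedron L b) = LaurentPolynomial.T (-1) +
      ∑ S : Finset E with IsSupportOf (stdPolyhedron L b) S, LaurentPolynomial.T
        (Module.finrank ℝ (vectorSpan ℝ (coordFace (stdPolyhedron L b) S)) : ℤ) := by
  have h : polytopeFaces (stdPolyhedron L b) =
      ((insert ∅ ((Finset.univ.filter (IsSupportOf (stdPolyhedron L b))).image
        (coordFace (stdPolyhedron L b))) : Finset (Set (E → ℝ))) : Set (Set (E → ℝ))) := by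
    rw [polytopeFaces_stdPolyhedron]
    simp
  rw [fPolynomial_eq_sum h, Finset.sum_insert, Finset.sum_image]
  · congr 1
    · simp [faceDim]
    · refine Finset.sum_congr rfl fun S hS => ?_
      rw [faceDim, if_pos (Finset.mem_filter.1 hS).2.coordFace_nonempty]
  · intro S hS T hT h
    exact coordFace_injOn _ (by simpa using hS) (by simpa using hT) h
  · intro h
    obtain ⟨S, hS, h⟩ := Finset.mem_image.1 h
    exact ((Finset.mem_filter.1 hS).2.coordFace_nonempty).ne_empty h

/-! ### Supports of flows on the complete graph -/

section Flow

variable {n : ℕ}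

/-- The initial vertex of an edge; it is never the sink. -/
def edgeTail (e : completeEdges n) : Fin n :=
  e.1.1.castLT (lt_of_lt_of_le (by simpa [completeEdges] using e.2 : e.1.1 < e.1.2)
    (Fin.le_last e.1.2))

@[simp]
theorem castSucc_edgeTail (e : completeEdges n) : (edgeTail e).castSucc = e.1.1 := rfl

theorem edge_lt (e : completeEdges n) : (edgeTail e).castSucc < e.1.2 := by
  simpa [completeEdges] using e.2

theorem fst_eq_castSucc_iff (e : completeEdges n) (i : Fin n) :
    e.1.1 = i.castSucc ↔ edgeTail e = i := by
  rw [← castSucc_edgeTail, Fin.castSucc_inj]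

/-- The outgoing minus the incoming flow at each vertex except the sink. -/
noncomputable def netflowMap (n : ℕ) : (completeEdges n → ℝ) →ₗ[ℝ] (Fin n → ℝ) :=
  LinearMap.pi fun i => (∑ e : completeEdges n with edgeTail e = i, LinearMap.proj e) -
    ∑ e : completeEdges n with e.1.2 = i.castSucc, LinearMap.proj e

theorem netflowMap_apply (f : completeEdges n → ℝ) (i : Fin n) :
    netflowMap n f i = (∑ e : completeEdges n with edgeTail e = i, f e) -
      ∑ e : completeEdges n with e.1.2 = i.castSucc, f e := by
  simp [netflowMap]

theorem completeFlowPolytope_eq (a : Fin n → ℕ) :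
    completeFlowPolytope a = stdPolyhedron (netflowMap n) (fun i => (a i : ℝ)) := by
  ext f
  simp only [completeFlowPolytope, flowPolytope, IsFlow, stdPolyhedron, Set.mem_ofPred_eq,
    funext_iff, netflowMap_apply, fst_eq_castSucc_iff, netflow, Fin.snoc_castSucc, Int.cast_natCast]

/-- An edge set in which a vertex has an outgoing edge exactly if it has an incoming edge or a
nonzero netflow. -/
def IsFlowSupport (a : Fin n → ℕ) (S : Finset (completeEdges n)) : Prop :=
  ∀ i : Fin n, (∃ e ∈ S, edgeTail e = i) ↔ a i ≠ 0 ∨ ∃ e ∈ S, e.1.2 = i.castSucc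

theorem sum_filter_pos_iff {E : Type*} [Fintype E] {f : E → ℝ} (hf : ∀ e, 0 ≤ f e)
    {S : Finset E} (hS : ∀ e, e ∈ S ↔ f e ≠ 0) (p : E → Prop) [DecidablePred p] :
    0 < ∑ e with p e, f e ↔ ∃ e ∈ S, p e := by
  rw [Finset.sum_pos_iff_of_nonneg fun e _ => hf e]
  simp only [Finset.mem_filter, Finset.mem_univ, true_and, hS, (hf _).lt_iff_ne']
  exact exists_congr fun e => and_comm

/-- At a vertex, the outgoing flow is the incoming flow plus the netflow, and each of these is
nonnegative. -/
theorem IsSupportOf.isFlowSupport {a : Fin n → ℕ} {S : Finset (completeEdges n)}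
    (h : IsSupportOf (completeFlowPolytope a) S) : IsFlowSupport a S := by
  rw [completeFlowPolytope_eq] at h
  obtain ⟨f, ⟨hf, hfa⟩, hS⟩ := h
  intro i
  rw [← sum_filter_pos_iff hf hS, ← sum_filter_pos_iff hf hS]
  have h1 := congrFun hfa i
  rw [netflowMap_apply] at h1
  have h2 := Finset.sum_nonneg fun e (_ : e ∈ Finset.univ.filter
    fun e : completeEdges n => e.1.2 = i.castSucc) => hf e
  rcases Nat.eq_zero_or_pos (a i) with h0 | h0
  · simp only [h0, Nat.cast_zero] at h1
    simp only [h0, ne_eq, not_true_eq_false, false_or]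
    rw [sub_eq_zero.1 h1]
  · have h3 : (0 : ℝ) < a i := by exact_mod_cast h0
    exact iff_of_true (by linarith) (Or.inl h0.ne')

/-- There is a solution `t` of the recursion for the total flow through each vertex, when a vertex
`i` receives `b i` from outside and sends `t i / c i` along each of its outgoing edges in `S`. -/
theorem exists_throughput (b c : Fin n → ℝ) (S : Finset (completeEdges n)) :
    ∃ t : Fin n → ℝ, ∀ i,
      t i = b i + ∑ e ∈ S with e.1.2 = i.castSucc, t (edgeTail e) / c (edgeTail e) := by
  classical
  let F : (i : Fin n) → ((j : Fin n) → j < i → ℝ) → ℝ := fun i t =>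
    b i + ∑ e ∈ S, if h : e.1.2 = i.castSucc then
      t (edgeTail e) (Fin.castSucc_lt_castSucc_iff.1 (h ▸ edge_lt e)) / c (edgeTail e) else 0
  refine ⟨wellFounded_lt.fix F, fun i => ?_⟩
  rw [wellFounded_lt.fix_eq F i, Finset.sum_filter]
  simp [F]

theorem IsFlowSupport.isSupportOf {a : Fin n → ℕ} {S : Finset (completeEdges n)}
    (h : IsFlowSupport a S) : IsSupportOf (completeFlowPolytope a) S := by
  classical
  -- Every vertex splits its throughput evenly among its outgoing edges in `S`.
  let c : Fin n → ℝ := fun i => (S.filter fun e => edgeTail e = i).card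
  obtain ⟨t, ht⟩ := exists_throughput (fun i => (a i : ℝ)) c S
  have hc : ∀ e ∈ S, 0 < c (edgeTail e) := fun e he => by
    simp only [c, Nat.cast_pos, Finset.card_pos]
    exact ⟨e, by simp [he]⟩
  have hpos : ∀ i, ((∃ e ∈ S, edgeTail e = i) → 0 < t i) ∧
      ((¬ ∃ e ∈ S, edgeTail e = i) → t i = 0) := by
    intro i
    induction i using WellFoundedLT.induction with
    | ind i ih =>
      have hin : ∀ e ∈ S.filter (fun e => e.1.2 = i.castSucc),
          0 < t (edgeTail e) / c (edgeTail e) := by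
        intro e he
        obtain ⟨he, hei⟩ := Finset.mem_filter.1 he
        exact div_pos ((ih _ (Fin.castSucc_lt_castSucc_iff.1 (hei ▸ edge_lt e))).1 ⟨e, he, rfl⟩)
          (hc e he)
      have hnn := Finset.sum_nonneg fun e he => (hin e he).le
      constructor
      · intro hi
        rw [ht i]
        rcases (h i).1 hi with h0 | ⟨e, he, hei⟩
        · have : (0 : ℝ) < a i := by exact_mod_cast Nat.pos_of_ne_zero h0
          linarith
        · have := Finset.sum_pos hin ⟨e, by simp [he, hei]⟩
          have : (0 : ℝ) ≤ a i := Nat.cast_nonneg _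
          linarith
      · intro hi
        rw [h i] at hi
        push Not at hi
        rw [ht i, hi.1, Finset.filter_false_of_mem hi.2]
        simp
  have htS : ∀ e ∈ S, 0 < t (edgeTail e) / c (edgeTail e) := fun e he =>
    div_pos ((hpos _).1 ⟨e, he, rfl⟩) (hc e he)
  rw [completeFlowPolytope_eq]
  refine ⟨fun e => if e ∈ S then t (edgeTail e) / c (edgeTail e) else 0, ⟨fun e => ?_, ?_⟩,
    fun e => ?_⟩
  · dsimp only
    split_ifs with he
    exacts [(htS e he).le, le_rfl]
  · ext i
    have hin : ∀ p : completeEdges n → Prop, [DecidablePred p] →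
        (∑ e with p e, if e ∈ S then t (edgeTail e) / c (edgeTail e) else 0) =
        ∑ e ∈ S with p e, t (edgeTail e) / c (edgeTail e) := by
      intro p _
      rw [Finset.sum_filter, Finset.sum_filter, ← Finset.sum_filter_add_sum_filter_not
        Finset.univ (· ∈ S), Finset.sum_eq_zero (s := Finset.univ.filter (· ∉ S)), add_zero]
      · simp only [Finset.filter_mem_eq_inter, Finset.univ_inter]
        exact Finset.sum_congr rfl fun e he => by simp [he]
      · intro e he
        simp [(Finset.mem_filter.1 he).2]
    have hout : ∑ e ∈ S with edgeTail e = i, t (edgeTail e) / c (edgeTail e) = t i := by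
      rw [Finset.sum_congr rfl (g := fun _ => t i / c i)
        (fun e he => by rw [(Finset.mem_filter.1 he).2]), Finset.sum_const, nsmul_eq_mul]
      by_cases hi : ∃ e ∈ S, edgeTail e = i
      · obtain ⟨e, he, rfl⟩ := hi
        exact mul_div_cancel₀ _ (hc e he).ne'
      · rw [(hpos i).2 hi, zero_div, mul_zero]
    rw [netflowMap_apply, hin, hin, hout]
    linarith [ht i]
  · dsimp only
    split_ifs with he
    · exact iff_of_true he (htS e he).ne'
    · exact iff_of_false he (by simp)

theorem isSupportOf_completeFlowPolytope (a : Fin n → ℕ) (S : Finset (completeEdges n)) :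
    IsSupportOf (completeFlowPolytope a) S ↔ IsFlowSupport a S :=
  ⟨IsSupportOf.isFlowSupport, IsFlowSupport.isSupportOf⟩

/-- The vertices with an outgoing edge in `S`. -/
def activeVertices (S : Finset (completeEdges n)) : Finset (Fin n) :=
  S.image edgeTail

theorem netflowMap_single (e : completeEdges n) (i : Fin n) :
    netflowMap n (Pi.single e 1) i =
      (if edgeTail e = i then 1 else 0) - if e.1.2 = i.castSucc then 1 else 0 := by
  classical
  rw [netflowMap_apply, Finset.sum_filter, Finset.sum_filter]
  congr 1 <;>
  · rw [Finset.sum_eq_single e]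
    · simp
    · intro e' _ h
      simp [Pi.single_eq_of_ne h]
    · simp

/-- The edges of a flow support impose independent balance equations at the active vertices: the
incidence matrix is triangular with respect to the order of the vertices. -/
theorem map_netflowMap_range_extendZero {a : Fin n → ℕ} {S : Finset (completeEdges n)}
    (h : IsFlowSupport a S) :
    (LinearMap.range (extendZero S)).map (netflowMap n) =
      LinearMap.range (extendZero (activeVertices S)) := by
  classical
  apply le_antisymm
  · rintro _ ⟨v, hv, rfl⟩
    have hv := (mem_range_extendZero S v).1 hv
    rw [mem_range_extendZero]
    intro i hi
    have hi' : ¬ ∃ e ∈ S, edgeTail e = i := by simpa [activeVertices] using hi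
    have hi'' := mt (fun hh => (h i).2 (Or.inr hh)) hi'
    rw [netflowMap_apply, Finset.sum_eq_zero, Finset.sum_eq_zero, sub_zero]
    · exact fun e he => hv e fun heS => hi'' ⟨e, heS, (Finset.mem_filter.1 he).2⟩
    · exact fun e he => hv e fun heS => hi' ⟨e, heS, (Finset.mem_filter.1 he).2⟩
  · have key : ∀ i ∈ activeVertices S, Pi.single i (1 : ℝ) ∈
        (LinearMap.range (extendZero S)).map (netflowMap n) := by
      intro i
      induction i using WellFoundedGT.induction with
      | ind i ih =>
        intro hi
        obtain ⟨e, he, rfl⟩ := Finset.mem_image.1 hi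
        have hmem : netflowMap n (Pi.single e 1) ∈
            (LinearMap.range (extendZero S)).map (netflowMap n) := by
          refine Submodule.mem_map_of_mem ((mem_range_extendZero S _).2 fun e' he' => ?_)
          exact Pi.single_eq_of_ne (by rintro rfl; exact he' he) _
        rcases Fin.eq_castSucc_or_eq_last e.1.2 with ⟨j, hj⟩ | hlast
        · have hij : edgeTail e < j := Fin.castSucc_lt_castSucc_iff.1 (hj ▸ edge_lt e)
          have hjA : j ∈ activeVertices S := by
            obtain ⟨e', he', h'⟩ := (h j).2 (Or.inr ⟨e, he, hj⟩)
            exact Finset.mem_image.2 ⟨e', he', h'⟩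
          convert Submodule.add_mem _ hmem (ih j hij hjA) using 1
          ext k
          rw [Pi.add_apply, netflowMap_single, hj]
          simp [Pi.single_apply, eq_comm]
        · convert hmem using 1
          ext k
          rw [netflowMap_single, hlast]
          simp [Pi.single_apply, (Fin.castSucc_lt_last k).ne', eq_comm]
    intro w hw
    have hw := (mem_range_extendZero _ w).1 hw
    have : w = ∑ i, w i • Pi.single i (1 : ℝ) := by
      ext k
      simp [Pi.single_apply]
    rw [this]
    refine Submodule.sum_mem _ fun i _ => ?_
    by_cases hi : i ∈ activeVertices S
    · exact Submodule.smul_mem _ _ (key i hi)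
    · simp [hw i hi]

theorem finrank_vectorSpan_flowFace {a : Fin n → ℕ} {S : Finset (completeEdges n)}
    (h : IsFlowSupport a S) :
    (activeVertices S).card +
      Module.finrank ℝ (vectorSpan ℝ (coordFace (completeFlowPolytope a) S)) = S.card := by
  have hS := h.isSupportOf
  rw [completeFlowPolytope_eq] at hS ⊢
  rw [← finrank_vectorSpan_coordFace hS, map_netflowMap_range_extendZero h,
    finrank_range_extendZero]

end Flow

/-! ### Families of out-neighbourhoods -/

section OutSets

variable {n : ℕ}

/-- The families assigning to each vertex except the sink a set of larger vertices. -/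
def outFamilies (n : ℕ) : Finset (Fin n → Finset (Fin (n + 1))) :=
  Fintype.piFinset fun i => (Finset.Ioi i.castSucc).powerset

theorem mem_outFamilies {O : Fin n → Finset (Fin (n + 1))} :
    O ∈ outFamilies n ↔ ∀ i, ∀ j ∈ O i, i.castSucc < j := by
  simp [outFamilies, Finset.subset_iff]

/-- The edge set with given out-neighbourhoods. -/
def edgeSet (O : Fin n → Finset (Fin (n + 1))) : Finset (completeEdges n) :=
  {e | e.1.2 ∈ O (edgeTail e)}

theorem mem_edgeSet {O : Fin n → Finset (Fin (n + 1))} {e : completeEdges n} :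
    e ∈ edgeSet O ↔ e.1.2 ∈ O (edgeTail e) := by
  simp [edgeSet]

/-- The condition on the out-neighbourhoods that characterizes the supports of flows: a vertex has
an outgoing edge exactly if it has an incoming edge or a nonzero netflow. -/
def IsFlowFamily (a : Fin n → ℕ) (O : Fin n → Finset (Fin (n + 1))) : Prop :=
  ∀ i, O i ≠ ∅ ↔ a i ≠ 0 ∨ ∃ k, i.castSucc ∈ O k

theorem exists_edge {O : Fin n → Finset (Fin (n + 1))} (hO : O ∈ outFamilies n) {i : Fin n}
    {j : Fin (n + 1)} (hj : j ∈ O i) : ∃ e ∈ edgeSet O, edgeTail e = i ∧ e.1.2 = j :=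
  ⟨⟨(i.castSucc, j), by simpa [completeEdges] using mem_outFamilies.1 hO i j hj⟩,
    mem_edgeSet.2 hj, by simp [edgeTail], rfl⟩

theorem isFlowSupport_edgeSet {a : Fin n → ℕ} {O : Fin n → Finset (Fin (n + 1))}
    (hO : O ∈ outFamilies n) : IsFlowSupport a (edgeSet O) ↔ IsFlowFamily a O := by
  refine forall_congr' fun i => iff_congr ?_ (or_congr_right ?_)
  · rw [← Finset.nonempty_iff_ne_empty]
    constructor
    · rintro ⟨e, he, rfl⟩
      exact ⟨_, mem_edgeSet.1 he⟩
    · rintro ⟨j, hj⟩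
      obtain ⟨e, he, hei, -⟩ := exists_edge hO hj
      exact ⟨e, he, hei⟩
  · constructor
    · rintro ⟨e, he, hei⟩
      exact ⟨edgeTail e, hei ▸ mem_edgeSet.1 he⟩
    · rintro ⟨k, hk⟩
      obtain ⟨e, he, -, hej⟩ := exists_edge hO hk
      exact ⟨e, he, hej⟩

theorem edge_ext {e e' : completeEdges n} (h : edgeTail e = edgeTail e') (h' : e.1.2 = e'.1.2) :
    e = e' := by
  refine Subtype.ext (Prod.ext ?_ h')
  rw [← castSucc_edgeTail, h, castSucc_edgeTail]

theorem card_filter_edgeSet {O : Fin n → Finset (Fin (n + 1))} (hO : O ∈ outFamilies n)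
    (i : Fin n) : {e ∈ edgeSet O | edgeTail e = i}.card = (O i).card := by
  refine Finset.card_nbij (fun e => e.1.2) ?_ ?_ ?_
  · intro e he
    obtain ⟨he', rfl⟩ := Finset.mem_filter.1 he
    exact mem_edgeSet.1 he'
  · intro e he e' he' h
    simp only [Finset.coe_filter, Set.mem_ofPred_eq] at he he'
    exact edge_ext (he.2.trans he'.2.symm) h
  · intro j hj
    obtain ⟨e, he, hei, hej⟩ := exists_edge hO hj
    exact ⟨e, by simp [he, hei], hej⟩

/-- Each active vertex `i` contributes `1 + (|O i| - 1)` edges; by truncated subtraction the other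
vertices contribute nothing to the sum. -/
theorem card_activeVertices_add_sum {O : Fin n → Finset (Fin (n + 1))} (hO : O ∈ outFamilies n) :
    (activeVertices (edgeSet O)).card + ∑ i, ((O i).card - 1) = (edgeSet O).card := by
  have h : activeVertices (edgeSet O) = Finset.univ.filter fun i => 0 < (O i).card := by
    ext i
    simp only [activeVertices, Finset.mem_image, Finset.mem_filter, Finset.mem_univ, true_and]
    rw [← card_filter_edgeSet hO, Finset.card_pos, Finset.filter_nonempty_iff]
  rw [h, Finset.card_filter, ← Finset.sum_add_distrib, Finset.card_eq_sum_card_fiberwise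
    (f := edgeTail) (t := Finset.univ) (by simp)]
  refine Finset.sum_congr rfl fun i _ => ?_
  rw [card_filter_edgeSet hO]
  split_ifs <;> omega

theorem edgeSet_injOn : Set.InjOn edgeSet (outFamilies n : Set (Fin n → Finset (Fin (n + 1)))) := by
  have key : ∀ O ∈ outFamilies n, ∀ O', edgeSet O = edgeSet O' → ∀ i, O i ⊆ O' i := by
    intro O hO O' h i j hj
    obtain ⟨e, he, rfl, rfl⟩ := exists_edge hO hj
    rw [h] at he
    exact mem_edgeSet.1 he
  intro O hO O' hO' h
  ext1 i
  exact (key O hO O' h i).antisymm (key O' hO' O h.symm i)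

theorem exists_edgeSet_eq (S : Finset (completeEdges n)) : ∃ O ∈ outFamilies n, edgeSet O = S := by
  refine ⟨fun i => {e ∈ S | edgeTail e = i}.image fun e => e.1.2, mem_outFamilies.2 ?_, ?_⟩
  · intro i j hj
    obtain ⟨e, he, rfl⟩ := Finset.mem_image.1 hj
    obtain ⟨-, rfl⟩ := Finset.mem_filter.1 he
    exact edge_lt e
  · ext e
    simp only [mem_edgeSet, Finset.mem_filter, Finset.mem_image]
    constructor
    · rintro ⟨e', ⟨he', h⟩, h'⟩
      exact edge_ext h h' ▸ he'
    · exact fun he => ⟨e, ⟨he, rfl⟩, rfl⟩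

open Classical in
/-- A face of the flow polytope contributes `x ^ (|O i| - 1)` for each vertex `i` with
out-neighbourhood `O i ≠ ∅` in its support. By truncated subtraction, the factor of a vertex with
`O i = ∅` is `1`. -/
theorem fPolynomial_completeFlowPolytope (a : Fin n → ℕ) :
    fPolynomial (completeFlowPolytope a) = LaurentPolynomial.T (-1) +
      ∑ O ∈ outFamilies n with IsFlowFamily a O,
        ∏ i, (LaurentPolynomial.T 1 : ℤ[T;T⁻¹]) ^ ((O i).card - 1) := by
  have h := fPolynomial_stdPolyhedron (netflowMap n) (fun i => (a i : ℝ))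
  rw [← completeFlowPolytope_eq] at h
  simp only [isSupportOf_completeFlowPolytope] at h
  rw [h]
  congr 1
  symm
  refine Finset.sum_nbij edgeSet ?_ ?_ ?_ ?_
  · intro O hO
    obtain ⟨hO, hO'⟩ := Finset.mem_filter.1 hO
    simpa [isFlowSupport_edgeSet hO] using hO'
  · exact edgeSet_injOn.mono fun O hO => (Finset.mem_filter.1 hO).1
  · intro S hS
    obtain ⟨O, hO, rfl⟩ := exists_edgeSet_eq S
    refine ⟨O, ?_, rfl⟩
    rw [Finset.mem_coe, Finset.mem_filter, isFlowSupport_edgeSet hO] at hS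
    rw [Finset.mem_coe, Finset.mem_filter]
    exact ⟨hO, hS.2⟩
  · intro O hO
    obtain ⟨hO, hO'⟩ := Finset.mem_filter.1 hO
    have h1 := card_activeVertices_add_sum hO
    have h2 := finrank_vectorSpan_flowFace ((isFlowSupport_edgeSet hO).2 hO')
    rw [Finset.prod_pow_eq_pow_sum, LaurentPolynomial.T_pow, mul_one]
    congr 2
    omega

end OutSets

/-! ### Inclusion–exclusion over the vertices without incoming edges -/

section InclusionExclusion

variable {R : Type*} [CommRing R] {n : ℕ}

/-- The weight `x ^ (|O| - 1)` of a nonempty set. -/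
noncomputable def nonemptyWeight {α : Type*} (x : R) (O : Finset α) : R :=
  open Classical in if O = ∅ then 0 else x ^ (O.card - 1)

theorem mul_sum_nonemptyWeight {α : Type*} (x : R) (T : Finset α) :
    x * ∑ O ∈ T.powerset, nonemptyWeight x O = (x + 1) ^ T.card - 1 := by
  classical
  have h := Finset.sum_pow_mul_eq_add_pow x 1 T
  rw [← h, Finset.mul_sum, eq_sub_iff_add_eq, ← Finset.sum_erase_add _ _ T.empty_mem_powerset,
    ← Finset.sum_erase_add (a := ∅) _ _ T.empty_mem_powerset]
  simp only [nonemptyWeight, if_true, mul_zero, add_zero, Finset.card_empty, pow_zero, one_pow,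
    mul_one]
  congr 1
  refine Finset.sum_congr rfl fun O hO => ?_
  have h0 := (Finset.mem_erase.1 hO).1
  rw [if_neg h0, ← pow_succ', Nat.sub_add_cancel (Finset.card_pos.2
    (Finset.nonempty_iff_ne_empty.2 h0))]

/-- The larger vertices that do not belong to `U`, including the sink. -/
def allowedHeads (U : Finset (Fin n)) (i : Fin n) : Finset (Fin (n + 1)) :=
  {j | i.castSucc < j ∧ ∀ u ∈ U, u.castSucc ≠ j}

open Classical in
/-- The total weight of the nonempty subsets of `allowedHeads U i` for a vertex `i ∉ U`; the weight
`1` of the empty set minus this for `i ∈ U`. -/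
noncomputable def vertexFactor (x : R) (U : Finset (Fin n)) (i : Fin n) : R :=
  if i ∈ U then 1 - ∑ O ∈ (allowedHeads U i).powerset, nonemptyWeight x O
  else ∑ O ∈ (allowedHeads U i).powerset, nonemptyWeight x O

open Classical in
/-- For a vertex of netflow zero, the weight `[O i = ∅] N + [O i ≠ ∅] (1 - N) x ^ (|O i| - 1)`, with
`N` the indicator of having no incoming edge, equals `N ([O i = ∅] - w) + w` with
`w = [O i ≠ ∅] x ^ (|O i| - 1)`. The set `U` collects the vertices whose first summand is taken in
the expansion of the product. -/
theorem ite_isFlowFamily_prod (x : R) (a : Fin n → ℕ) (O : Fin n → Finset (Fin (n + 1))) :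
    (if IsFlowFamily a O then ∏ i, x ^ ((O i).card - 1) else 0) =
      ∑ U ∈ (Finset.univ.filter fun i => a i = 0).powerset, if ∀ u ∈ U, ∀ k, u.castSucc ∉ O k then
        ∏ i, (if i ∈ U then (if O i = ∅ then 1 else 0) - nonemptyWeight x (O i)
          else nonemptyWeight x (O i)) else 0 := by
  have h1 : (if IsFlowFamily a O then ∏ i, x ^ ((O i).card - 1) else 0) =
      ∏ i, ((if a i = 0 ∧ ∀ k, i.castSucc ∉ O k then
        (if O i = ∅ then 1 else 0) - nonemptyWeight x (O i) else 0) + nonemptyWeight x (O i)) := by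
    split_ifs with h
    · refine Finset.prod_congr rfl fun i _ => ?_
      have hi := h i
      by_cases h0 : O i = ∅
      · have : a i = 0 ∧ ∀ k, i.castSucc ∉ O k := by
          simpa [h0] using hi
        rw [if_pos this]
        simp [h0, nonemptyWeight]
      · have : ¬ (a i = 0 ∧ ∀ k, i.castSucc ∉ O k) := by
          have := hi.1 h0
          rintro ⟨h2, h3⟩
          rcases this with h4 | ⟨k, hk⟩
          exacts [h4 h2, h3 k hk]
        rw [if_neg this]
        simp [h0, nonemptyWeight]
    · obtain ⟨i, hi⟩ := not_forall.1 h
      refine (Finset.prod_eq_zero (Finset.mem_univ i) ?_).symm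
      by_cases h0 : O i = ∅
      · have : ¬ (a i = 0 ∧ ∀ k, i.castSucc ∉ O k) := by
          rintro ⟨h2, h3⟩
          exact hi (by simp [h0, h2, h3])
        rw [if_neg this]
        simp [h0, nonemptyWeight]
      · have : a i = 0 ∧ ∀ k, i.castSucc ∉ O k := by
          simpa [h0] using hi
        rw [if_pos this]
        simp [h0]
  rw [h1, Finset.prod_add]
  symm
  refine Finset.sum_subset_zero_on_sdiff (Finset.powerset_mono.2 (Finset.subset_univ _)) ?_ ?_
  · intro U hU
    obtain ⟨u, hu, hu'⟩ := Finset.not_subset.1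
      (fun h => (Finset.mem_sdiff.1 hU).2 (Finset.mem_powerset.2 h))
    rw [Finset.prod_eq_zero hu, zero_mul]
    rw [if_neg]
    simpa using fun h => absurd h (by simpa using hu')
  · intro U hU
    have hU : ∀ u ∈ U, a u = 0 := fun u hu => by
      simpa using Finset.mem_powerset.1 hU hu
    split_ifs with h
    · rw [Finset.prod_ite, Finset.filter_mem_eq_inter, Finset.univ_inter, Finset.filter_not,
        Finset.filter_mem_eq_inter, Finset.univ_inter]
      congr 1
      exact Finset.prod_congr rfl fun u hu => (if_pos ⟨hU u hu, h u hu⟩).symm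
    · push Not at h
      obtain ⟨u, hu, k, hk⟩ := h
      rw [Finset.prod_eq_zero hu, zero_mul]
      rw [if_neg fun h => h.2 k hk]

open Classical in
/-- Once the set `U` of vertices required to have no incoming edge is fixed, the out-neighbourhoods
are independent, and the sum over all families factors over the vertices. -/
theorem sum_isFlowFamily (x : R) (a : Fin n → ℕ) :
    ∑ O ∈ outFamilies n with IsFlowFamily a O, ∏ i, x ^ ((O i).card - 1) =
      ∑ U ∈ (Finset.univ.filter fun i => a i = 0).powerset, ∏ i, vertexFactor x U i := by
  rw [Finset.sum_filter, Finset.sum_congr rfl fun O _ => ite_isFlowFamily_prod x a O,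
    Finset.sum_comm]
  refine Finset.sum_congr rfl fun U _ => ?_
  have h1 : (outFamilies n).filter (fun O => ∀ u ∈ U, ∀ k, u.castSucc ∉ O k) =
      Fintype.piFinset fun i => (allowedHeads U i).powerset := by
    ext O
    simp only [Finset.mem_filter, mem_outFamilies, Fintype.mem_piFinset, Finset.mem_powerset,
      Finset.subset_iff, allowedHeads, Finset.mem_univ, true_and]
    constructor
    · rintro ⟨h, h'⟩ i j hj
      exact ⟨h i j hj, fun u hu huj => h' u hu i (huj ▸ hj)⟩
    · intro h
      exact ⟨fun i j hj => (h i hj).1, fun u hu k hk => (h k hk).2 u hu rfl⟩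
  rw [← Finset.sum_filter, h1, ← Finset.prod_univ_sum (fun i => (allowedHeads U i).powerset)
    (fun i O => if i ∈ U then (if O = ∅ then 1 else 0) - nonemptyWeight x O
      else nonemptyWeight x O)]
  refine Finset.prod_congr rfl fun i _ => ?_
  rw [vertexFactor]
  split_ifs
  · rw [Finset.sum_sub_distrib]
    simp
  · rfl

theorem mul_vertexFactor (x : R) (U : Finset (Fin n)) (i : Fin n) :
    x * vertexFactor x U i = if i ∈ U then -((x + 1) ^ (allowedHeads U i).card - (x + 1))
      else (x + 1) ^ (allowedHeads U i).card - 1 := by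
  have h := mul_sum_nonemptyWeight x (allowedHeads U i)
  rw [vertexFactor]
  split_ifs
  · rw [mul_sub, h]
    ring
  · exact h

end InclusionExclusion

/-! ### Products over the blocks of a composition -/

namespace Composition

variable {n : ℕ}

theorem mem_boundaries_iff (β : Composition n) (x : Fin (n + 1)) :
    x ∈ β.boundaries ↔ ∃ k ≤ β.length, β.sizeUpTo k = x := by
  simp only [boundaries, Finset.mem_map, Finset.mem_univ, true_and]
  constructor
  · rintro ⟨k, rfl⟩
    exact ⟨k, Nat.lt_succ_iff.1 k.2, rfl⟩
  · rintro ⟨k, hk, h⟩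
    exact ⟨⟨k, Nat.lt_succ_iff.2 hk⟩, Fin.ext h⟩

theorem succ_embedding_mem_boundaries_iff (β : Composition n) (i : Fin β.length)
    (j : Fin (β.blocksFun i)) :
    (β.embedding i j).succ ∈ β.boundaries ↔ (j : ℕ) + 1 = β.blocksFun i := by
  rw [mem_boundaries_iff]
  have hs := β.sizeUpTo_succ' i
  simp only [Fin.val_succ, coe_embedding]
  constructor
  · rintro ⟨k, -, hk⟩
    have hj := j.2
    have h1 : (i : ℕ) < k := by
      by_contra! h
      have := β.monotone_sizeUpTo h
      omega
    have := β.monotone_sizeUpTo (Nat.succ_le_of_lt h1)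
    simp only [Nat.succ_eq_add_one] at this
    omega
  · intro h
    exact ⟨i + 1, i.2, by omega⟩

/-- Each block has one last position, with factor `H`, and its other positions have factor `G`. -/
theorem prod_ite_succ_mem_boundaries {R : Type*} [CommMonoid R] (β : Composition n)
    (G H : ℕ → R) :
    ∏ p : Fin n, (if p.succ ∈ β.boundaries then H (β.index p) else G (β.index p)) =
      ∏ i : Fin β.length, H i * G i ^ (β.blocksFun i - 1) := by
  rw [← β.prod_prod_apply_embedding]
  refine Finset.prod_congr rfl fun i _ => ?_
  simp only [index_embedding, succ_embedding_mem_boundaries_iff]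
  have key : ∀ m, 0 < m → ∏ j : Fin m, (if (j : ℕ) + 1 = m then H i else G i) =
      H i * G i ^ (m - 1) := by
    rintro (_ | m) hm
    · exact absurd hm (lt_irrefl 0)
    · rw [Fin.prod_univ_castSucc, mul_comm]
      simp [Fin.is_lt _ |>.ne]
  exact key _ (β.one_le_blocksFun i)

/-- The number of blocks of a composition that end before `p` is the index of the block of `p`. -/
theorem card_filter_lt_succ_mem_boundaries (β : Composition n) (p : Fin n) :
    (Finset.univ.filter fun q : Fin n => q < p ∧ q.succ ∈ β.boundaries).card = β.index p := by
  have hpos : ∀ k : Fin β.length, 0 < β.blocksFun k := fun k => β.one_le_blocksFun k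
  rw [← Fin.card_Iio]
  symm
  refine Finset.card_nbij' (fun k => β.embedding k ⟨β.blocksFun k - 1, Nat.sub_one_lt (hpos k).ne'⟩)
    β.index ?_ ?_ ?_ ?_
  · intro k hk
    have hk : (k : ℕ) < β.index p := by simpa using hk
    have h0 := hpos k
    rw [Finset.mem_coe, Finset.mem_filter, succ_embedding_mem_boundaries_iff]
    refine ⟨Finset.mem_univ _, ?_, Nat.sub_add_cancel h0⟩
    rw [Fin.lt_def, coe_embedding]
    have h1 := β.monotone_sizeUpTo (Nat.succ_le_of_lt hk)
    have h2 := β.sizeUpTo_index_le p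
    have h3 := β.sizeUpTo_succ' k
    simp only [Nat.succ_eq_add_one] at h1
    omega
  · intro q hq
    simp only [Finset.coe_filter, Finset.mem_univ, true_and, Set.mem_ofPred_eq] at hq
    rw [Finset.coe_Iio, Set.mem_Iio, Fin.lt_def]
    have h1 := hq.2
    rw [← β.embedding_comp_inv q, succ_embedding_mem_boundaries_iff, coe_invEmbedding] at h1
    have h2 := β.sizeUpTo_index_le q
    have h3 := β.sizeUpTo_succ' (β.index q)
    have h4 := β.lt_sizeUpTo_index_succ p
    have h5 : (q : ℕ) < p := hq.1
    by_contra! h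
    have := β.monotone_sizeUpTo (Nat.succ_le_succ h)
    simp only [Nat.succ_eq_add_one, Fin.val_succ] at this h4
    omega
  · intro k _
    simp
  · intro q hq
    simp only [Finset.coe_filter, Finset.mem_univ, true_and, Set.mem_ofPred_eq] at hq
    have h1 := hq.2
    rw [← β.embedding_comp_inv q, succ_embedding_mem_boundaries_iff, coe_invEmbedding] at h1
    have h2 := β.sizeUpTo_index_le q
    ext
    rw [coe_embedding]
    dsimp only
    omega

theorem boundaries_injective : Function.Injective (boundaries : Composition n → _) := by
  intro β γ h
  apply (compositionEquiv n).injective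
  exact CompositionAsSet.ext h

/-- `n - ℓ(β)` is the sum of the parts diminished by one. -/
theorem sum_blocksFun_sub_one (β : Composition n) :
    ∑ i, (β.blocksFun i - 1) = n - β.length := by
  have h : ∑ i, (β.blocksFun i - 1) + ∑ _i : Fin β.length, 1 = n := by
    rw [← Finset.sum_add_distrib]
    simp only [Nat.sub_add_cancel (β.one_le_blocksFun _), β.sum_blocksFun]
  rw [Fin.sum_const, smul_eq_mul, mul_one] at h
  omega

end Composition

/-! ### Compositions as sets of vertices -/

section NonClosing

variable {n : ℕ}

/-- The vertices that do not close a block of `β` when the vertices are read from right to left. -/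
def nonClosing (β : Composition n) : Finset (Fin n) :=
  {i | i.castSucc.rev ∉ β.boundaries}

theorem mem_nonClosing {β : Composition n} {i : Fin n} :
    i ∈ nonClosing β ↔ i.rev.succ ∉ β.boundaries := by
  simp [nonClosing, Fin.rev_castSucc]

theorem zero_mem_boundaries (β : Composition n) : 0 ∈ β.boundaries :=
  β.toCompositionAsSet.zero_mem

theorem nonClosing_subset_nonClosing_iff {β γ : Composition n} :
    nonClosing β ⊆ nonClosing γ ↔ Refines β γ := by
  constructor
  · intro h x hx
    induction x using Fin.cases with
    | zero => exact zero_mem_boundaries β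
    | succ p =>
      by_contra hp
      have := h (mem_nonClosing.2 (by rwa [Fin.rev_rev]) : p.rev ∈ nonClosing β)
      rw [mem_nonClosing, Fin.rev_rev] at this
      exact this hx
  · intro h i hi
    rw [mem_nonClosing] at hi ⊢
    exact fun h' => hi (h h')

theorem nonClosing_injective : Function.Injective (nonClosing : Composition n → _) := by
  intro β γ h
  apply Composition.boundaries_injective
  exact (nonClosing_subset_nonClosing_iff.1 h.ge).antisymm
    (nonClosing_subset_nonClosing_iff.1 h.le)

/-- The vertex `0` always closes the last block. -/
theorem exists_nonClosing_eq {U : Finset (Fin n)} (hU : ∀ u ∈ U, (u : ℕ) ≠ 0) :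
    ∃ β : Composition n, nonClosing β = U := by
  refine ⟨CompositionAsSet.toComposition
    { boundaries := insert 0 (Uᶜ.image fun i => i.rev.succ)
      zero_mem := by simp
      getLast_mem := ?_ }, ?_⟩
  · rcases n with _ | n
    · simp
    · refine Finset.mem_insert_of_mem (Finset.mem_image.2 ⟨0, ?_, by simp⟩)
      exact Finset.mem_compl.2 fun h => hU 0 h rfl
  · ext i
    rw [mem_nonClosing, CompositionAsSet.toComposition_boundaries]
    simp [Fin.succ_ne_zero]

theorem nonClosing_revcomp (a : Fin n → ℕ) (ha : ∀ h : 0 < n, a ⟨0, h⟩ ≠ 0) :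
    nonClosing (revcomp a) = Finset.univ.filter fun i => a i = 0 := by
  ext i
  rw [mem_nonClosing, revcomp, CompositionAsSet.toComposition_boundaries]
  have h0 : i.rev.succ = Fin.last n → a i ≠ 0 := by
    intro h
    rw [← Fin.rev_castSucc, ← Fin.rev_zero, Fin.rev_inj] at h
    have : i = ⟨0, i.pos⟩ := Fin.ext (by simpa using congrArg Fin.val h)
    rw [this]
    exact ha i.pos
  simp only [Fin.rev_castSucc, Finset.mem_insert, Fin.succ_ne_zero, false_or, Finset.mem_image,
    Finset.mem_filter, Finset.mem_univ, true_and, Fin.succ_inj, Fin.rev_inj, exists_eq_right]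
  tauto

/-- The edges from `i` to a vertex outside `U` lead to the sink or to a vertex closing one of the
blocks to the right of `i`. -/
theorem card_allowedHeads_nonClosing (β : Composition n) (i : Fin n) :
    (allowedHeads (nonClosing β) i).card = (β.index i.rev : ℕ) + 1 := by
  classical
  rw [← β.card_filter_lt_succ_mem_boundaries]
  have h : allowedHeads (nonClosing β) i = insert (Fin.last n)
      ((Finset.univ.filter fun q : Fin n => q < i.rev ∧ q.succ ∈ β.boundaries).image
        fun q => q.rev.castSucc) := by
    ext j
    induction j using Fin.lastCases with
    | last => simp [allowedHeads, Fin.castSucc_lt_last, (Fin.castSucc_lt_last _).ne]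
    | cast j =>
      have h1 : (∃ q : Fin n, (q < i.rev ∧ q.succ ∈ β.boundaries) ∧ q.rev = j) ↔
          i < j ∧ j.rev.succ ∈ β.boundaries := by
        constructor
        · rintro ⟨q, ⟨h, h'⟩, rfl⟩
          exact ⟨Fin.lt_rev_iff.1 h, by rwa [Fin.rev_rev]⟩
        · rintro ⟨h, h'⟩
          exact ⟨j.rev, ⟨Fin.rev_lt_rev.2 h, h'⟩, Fin.rev_rev j⟩
      have h2 : (∀ u ∈ nonClosing β, u ≠ j) ↔ j.rev.succ ∈ β.boundaries := by
        rw [← not_iff_not, ← mem_nonClosing]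
        simp
      simp only [allowedHeads, Finset.mem_filter, Finset.mem_univ, true_and,
        Fin.castSucc_lt_castSucc_iff, ne_eq, Fin.castSucc_inj, Finset.mem_insert,
        Finset.mem_image, (Fin.castSucc_lt_last j).ne, false_or, h1, ← h2]
  rw [h, Finset.card_insert_of_notMem, Finset.card_image_of_injective]
  · intro q q' h
    simpa using h
  · simp [(Fin.castSucc_lt_last _).ne]

/-- The product of the vertex factors, taken block by block. -/
theorem pow_mul_prod_vertexFactor {R : Type*} [CommRing R] (x : R) (β : Composition n) :
    x ^ n * ∏ i, vertexFactor x (nonClosing β) i =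
      (-1) ^ (n - β.length) * qPi β.length x *
        ∏ i : Fin β.length, ((x + 1) ^ ((i : ℕ) + 1) - (x + 1)) ^ (β.blocksFun i - 1) := by
  have h1 : x ^ n = ∏ _i : Fin n, x := by simp
  rw [h1, ← Finset.prod_mul_distrib]
  simp only [mul_vertexFactor, card_allowedHeads_nonClosing, mem_nonClosing, ite_not]
  rw [← Equiv.prod_comp Fin.revPerm]
  simp only [Fin.revPerm_apply, Fin.rev_rev]
  rw [β.prod_ite_succ_mem_boundaries (fun k => -((x + 1) ^ (k + 1) - (x + 1)))
    (fun k => (x + 1) ^ (k + 1) - 1), Finset.prod_mul_distrib, qPi_eq_prod,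
    Fin.prod_univ_eq_prod_range (fun k => (x + 1) ^ (k + 1) - 1),
    Finset.prod_congr rfl fun i _ => neg_pow _ _, Finset.prod_mul_distrib,
    Finset.prod_pow_eq_pow_sum, β.sum_blocksFun_sub_one]
  ring

end NonClosing

/-! ### The evaluation of `Q_α` -/

theorem map_qPi {R S : Type*} [CommRing R] [CommRing S] (f : R →+* S) (m : ℕ) (x : R) :
    f (qPi m x) = qPi m (f x) := by
  simp [qPi_eq_prod]

theorem laurentEval_laurentQ {n : ℕ} {R : Type*} [CommRing R] (u : Rˣ) (v : Fin n → R)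
    (α : Composition n) :
    laurentEval u v (laurentQ α) = ((u⁻¹ : Rˣ) : R) + ((u⁻¹ : Rˣ) : R) ^ n *
      ∑ β : Composition n with Refines β α, (-1) ^ (n - β.length) * qPi β.length (u : R) *
        ∏ i : Fin β.length, v (Fin.castLE β.length_le i) ^ (β.blocksFun i - 1) := by
  have hT : ∀ k : ℤ, laurentEval u v (LaurentPolynomial.T k) = ((u ^ k : Rˣ) : R) :=
    fun k => LaurentPolynomial.eval₂_T _ _ k
  have hC : ∀ p, laurentEval u v (LaurentPolynomial.C p) =
      MvPolynomial.eval₂Hom (Int.castRingHom R) v p := fun p => LaurentPolynomial.eval₂_C _ _ p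
  simp only [laurentQ, map_add, map_mul, map_sum, map_pow, map_neg, map_one, map_qPi, hT, hC,
    monomialSubOne, map_prod, MvPolynomial.coe_eval₂Hom, MvPolynomial.eval₂_X, zpow_neg, zpow_one,
    zpow_natCast, inv_pow, ← Units.val_pow_eq_pow_val]

theorem fPolynomial_eq_sum_prod_vertexFactor {n : ℕ} (a : Fin n → ℕ) :
    fPolynomial (completeFlowPolytope a) = ((laurentX⁻¹ : (ℤ[T;T⁻¹])ˣ) : ℤ[T;T⁻¹]) +
      ∑ U ∈ (Finset.univ.filter fun i => a i = 0).powerset,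
        ∏ i, vertexFactor (laurentX : ℤ[T;T⁻¹]) U i := by
  classical
  rw [fPolynomial_completeFlowPolytope, sum_isFlowFamily]
  rfl

theorem prod_vertexFactor {n : ℕ} {R : Type*} [CommRing R] (u : Rˣ) (β : Composition n) :
    ∏ i, vertexFactor (u : R) (nonClosing β) i = ((u⁻¹ : Rˣ) : R) ^ n *
      ((-1) ^ (n - β.length) * qPi β.length (u : R) * ∏ i : Fin β.length,
        (((u : R) + 1) ^ ((i : ℕ) + 1) - ((u : R) + 1)) ^ (β.blocksFun i - 1)) := by
  rw [← pow_mul_prod_vertexFactor, ← mul_assoc, ← mul_pow, Units.inv_mul, one_pow, one_mul]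

theorem fPolynomial_eq_laurentEval {n : ℕ} (a : Fin n → ℕ) (ha : ∀ h : 0 < n, a ⟨0, h⟩ ≠ 0) :
    fPolynomial (completeFlowPolytope a) = laurentEval laurentX
      (fun i : Fin n => ((laurentX : ℤ[T;T⁻¹]) + 1) ^ ((i : ℕ) + 1) - ((laurentX : ℤ[T;T⁻¹]) + 1))
      (laurentQ (revcomp a)) := by
  rw [fPolynomial_eq_sum_prod_vertexFactor, laurentEval_laurentQ, Finset.mul_sum]
  congr 1
  symm
  refine Finset.sum_nbij nonClosing ?_ nonClosing_injective.injOn ?_ ?_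
  · intro β hβ
    rw [Finset.mem_powerset, ← nonClosing_revcomp a ha, nonClosing_subset_nonClosing_iff]
    exact (Finset.mem_filter.1 hβ).2
  · intro U hU
    have hU := Finset.mem_powerset.1 (Finset.mem_coe.1 hU)
    obtain ⟨β, rfl⟩ := exists_nonClosing_eq (U := U) fun u hu h0 => by
      have : u = ⟨0, u.pos⟩ := Fin.ext h0
      exact ha u.pos (this ▸ (Finset.mem_filter.1 (hU hu)).2)
    refine ⟨β, ?_, rfl⟩
    rw [← nonClosing_revcomp a ha, nonClosing_subset_nonClosing_iff] at hU
    simpa using hU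
  · intro β _
    rw [prod_vertexFactor]
    rfl

theorem fPolynomial_of_pos {n : ℕ} (a : Fin n → ℕ) (ha : ∀ i, 0 < a i) :
    fPolynomial (completeFlowPolytope a) =
      ((laurentX⁻¹ : (ℤ[T;T⁻¹])ˣ) : ℤ[T;T⁻¹]) + qFactorial n ((laurentX : ℤ[T;T⁻¹]) + 1) := by
  have h0 : (Finset.univ.filter fun i => a i = 0) = ∅ :=
    Finset.filter_false_of_mem fun i _ => (ha i).ne'
  -- The only set of vertices of netflow zero is the empty set, the set of the composition `(1ⁿ)`.
  have h1 : nonClosing (Composition.ones n) = ∅ := by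
    obtain ⟨β, hβ⟩ := exists_nonClosing_eq (n := n) (U := ∅) (by simp)
    rw [← Finset.subset_empty, ← hβ, nonClosing_subset_nonClosing_iff]
    intro x _
    exact (Composition.mem_boundaries_iff _ x).2
      ⟨x, by simpa using Nat.lt_succ_iff.1 x.2, by simpa using Nat.lt_succ_iff.1 x.2⟩
  rw [fPolynomial_eq_sum_prod_vertexFactor, h0, Finset.powerset_empty, Finset.sum_singleton, ← h1,
    prod_vertexFactor]
  simp only [Composition.ones_length, Composition.ones_blocksFun, Nat.sub_self, pow_zero,
    Finset.prod_const_one, mul_one, one_mul, qPi]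
  rw [← mul_assoc, ← mul_pow, Units.inv_mul, one_pow, one_mul]

theorem finite_polytopeFaces_completeFlowPolytope {n : ℕ} (a : Fin n → ℕ) :
    (polytopeFaces (completeFlowPolytope a)).Finite := by
  rw [completeFlowPolytope_eq, polytopeFaces_stdPolyhedron]
  exact ((Set.toFinite _).image _).insert _

theorem mainTheorem1 (n : ℕ) (a : Fin n → ℕ) (ha : ∀ h : 0 < n, a ⟨0, h⟩ ≠ 0) :
    (polytopeFaces (completeFlowPolytope a)).Finite ∧
    fPolynomial (completeFlowPolytope a) =
      laurentEval laurentX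
        (fun i : Fin n => ((laurentX : ℤ[T;T⁻¹]) + 1) ^ ((i : ℕ) + 1) - ((laurentX : ℤ[T;T⁻¹]) + 1))
        (laurentQ (revcomp a)) ∧
    ((∀ i, 0 < a i) →
      fPolynomial (completeFlowPolytope a) =
        ((laurentX⁻¹ : (ℤ[T;T⁻¹])ˣ) : ℤ[T;T⁻¹]) + qFactorial n ((laurentX : ℤ[T;T⁻¹]) + 1)) :=
  ⟨finite_polytopeFaces_completeFlowPolytope a, fPolynomial_eq_laurentEval a ha,
    fPolynomial_of_pos a⟩
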